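/- Let $\mathbb B=\mathbb F_q\subseteq\mathbb F$ be finite fields with $[\mathbb F:\mathbb B]=\ell$, let $n=|\mathbb F|=q^\ell$, and let $\mathrm{RS}(\mathbb F,k)=\{(f(\alpha))_{\alpha\in\mathbb F}: f\in\mathbb F[x],\ \deg f<k\}$ be the full-length $[n,k]_{\mathbb F}$ Reed–Solomon code; put $\lambda_\alpha=\prod_{\gamma\ne\alpha}(\alpha-\gamma)^{-1}$. Let $1\le t<k$ and $m\ge 0$ be integers with $n=q^m+k+t-1$. A canonical random linear repair scheme consists of polynomials $P_1^{(\beta)},\dots,P_\ell^{(\beta)}\in\mathbb F[x]$ and functions $Q^{(\beta)}:\mathbb F\setminus\{\beta\}\to\mathbb F$ for each point $\beta$ to be repaired, and of a random polynomial $R\in\mathbb F[x]$ of degree at most $d$ ($d$ fixed; the law of $R$ may depend on $\beta$, and every polynomial of degree at most $d$ that does not vanish at $\beta$ has positive probability), such that: - for every $\beta$ and every realization of $R$ there are parity-check polynomials $r_1,\dots,r_\ell\in\mathbb F[x]$ of degree at most $n-k-1$ with $r_i(\alpha)=P^{(\beta)}_i(\alpha)Q^{(\beta)}(\alpha)R(\alpha)$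 for all $\alpha\ne\beta$; - whenever $R(\beta)\neq0$, these repair $f(\beta)$: the columns of the matrix $(\lambda_\alpha r_i(\alpha))_{\alpha,i}$ lie in the dual code, and its row $\beta$ has $\mathbb B$-rank $\ell$; - $Q^{(\beta)}$ genuinely involves $\beta$: for at least one pair $\beta\ne\beta'$ the functions $Q^{(\beta)}$ and $Q^{(\beta')}$ are not equal up to a nonzero scalar factor on $\mathbb F\setminus\{\beta,\beta'\}$. To repair $f(\beta)$, the query $Q^{(\beta)}(\alpha)R(\alpha)$ is sent to the node storing $f(\alpha)$, for each $\alpha\neq\beta$. The bandwidth for $f(\beta)$ is the maximum over the realizations of $R$ of $\sum_{\alpha\ne\beta}\operatorname{rank}_{\mathbb B}\{\lambda_\alpha r_i(\alpha): 1\le i\le\ell\}$. The scheme is $t$-private if, for $\beta$ uniform on $\mathbb F$ and every set $J$ of at most $t$ points, given that $\beta\notin J$ and given the queries received by the nodes in $J$, each point outside $J$ is the repaired point with probability $\frac1{n-|J|}$. Then every $t$-private canonical random linear repair scheme has, for each $\beta$, bandwidth at least $(n-1)(\ell-m)$ sub-symbols in $\mathbb B$. Moreover, if $m\geq 1$, this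 is attained: let $W$ be any $m$-dimensional $\mathbb B$-subspace of $\mathbb F$, $L_W(x)=\prod_{\omega\in W}(x-\omega)$, and $u_1,\dots,u_\ell$ any $\mathbb B$-basis of $\mathbb F$. The scheme with $P_i^{(\beta)}(x)=L_W(u_i(x-\beta))$, $Q^{(\beta)}(x)=1/(x-\beta)$ and $R(x)=R_0+\dots+R_{t-1}x^{t-1}$ with independent uniform coefficients in $\mathbb F$ (and $r_i(x)=\frac{L_W(u_i(x-\beta))}{x-\beta}R(x)$) is a $t$-private canonical random linear repair scheme whose bandwidth equals $(n-1)(\ell-m)$ for every $\beta$. -/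

import Mathlib

open Polynomial
open scoped ENNReal

noncomputable section

namespace PrivateRepair

section Codes

variable {F : Type*} [Field F]

/-- The Reed-Solomon code `RS(A, k)`: evaluations on `A` of polynomials of degree `< k`. -/
def rsCode (A : Finset F) (k : ℕ) : Submodule F (A → F) :=
  (Polynomial.degreeLT F k).map (LinearMap.pi fun α : A => Polynomial.leval (α : F))

/-- The dual (orthogonal complement) of a linear code. -/
def dualCode {ι : Type*} [Fintype ι] (C : Submodule F (ι → F)) : Submodule F (ι → F) where
  carrier := {w | ∀ c ∈ C, ∑ j, c j * w j = 0}
  zero_mem' := by intro c _; simp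
  add_mem' := by
    intro v w hv hw c hc
    simp only [Pi.add_apply, mul_add, Finset.sum_add_distrib]
    rw [hv c hc, hw c hc, add_zero]
  smul_mem' := by
    intro a w hw c hc
    have h : ∑ j, c j * (a • w) j = a * ∑ j, c j * w j := by
      rw [Finset.mul_sum]
      exact Finset.sum_congr rfl fun j _ => by simp only [Pi.smul_apply, smul_eq_mul]; ring
    rw [h, hw c hc, mul_zero]

open Classical in
/-- The multipliers `λ_α = (∏_{γ ∈ A, γ ≠ α} (α - γ))⁻¹` of the dual of `RS(A, k)`. -/
def multiplier (A : Finset F) (α : A) : F :=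
  (∏ γ ∈ A.erase (α : F), ((α : F) - γ))⁻¹

variable (B : Type*) [Field B] [Algebra B F]

open Classical in
/-- The bandwidth of the matrix `M` for the codeword symbol `j₀`: the sum, over the rows
`j ≠ j₀`, of the `B`-rank of the set of entries of the row. -/
def matrixBandwidth {ι : Type*} [Fintype ι] {l : ℕ} (j₀ : ι) (M : Matrix ι (Fin l) F) : ℕ :=
  ∑ j ∈ Finset.univ.erase j₀, Set.finrank B (Set.range (M j))

/-- `M` is an evaluation matrix with bandwidth `b` for the codeword symbol `j₀` of the code `C`:
its columns are dual codewords, the entries of row `j₀` have `B`-rank `l`, and the `B`-ranks of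
the other rows add up to `b`. -/
structure IsEvaluationMatrix {ι : Type*} [Fintype ι] {l : ℕ} (C : Submodule F (ι → F)) (j₀ : ι)
    (M : Matrix ι (Fin l) F) (b : ℕ) : Prop where
  column_mem : ∀ i, (fun j => M j i) ∈ dualCode C
  rank_eq : Set.finrank B (Set.range (M j₀)) = l
  bandwidth_eq : matrixBandwidth B j₀ M = b

end Codes

section Schemes

variable {F : Type*} [Field F]

/-- The data of a canonical random linear repair scheme with evaluation points `A`; `β` is always
the point whose codeword symbol `f(β)` is being repaired. -/
structure CanonicalScheme (A : Finset F) (l : ℕ) where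
  /-- the polynomials `P_i` -/
  P : A → Fin l → F[X]
  /-- the private function `Q`, on the helper points (the value at `β` itself is never used) -/
  Q : A → A → F
  /-- the degree bound of the random polynomial `R = R_0 + R_1 x + ⋯ + R_d x^d` -/
  d : ℕ
  /-- the law of the random polynomial `R` -/
  law : A → PMF F[X]
  /-- the parity-check polynomials `r_i = P_i Q R` used when the random polynomial is `R` -/
  r : A → F[X] → Fin l → F[X]

namespace CanonicalScheme

variable {A : Finset F} {l : ℕ} (S : CanonicalScheme A l)

/-- The query `Q(α) R(α)` sent to the node storing `f(α)`. -/
def query (β : A) (R : F[X]) (α : A) : F := S.Q β α * R.eval (α : F)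

/-- The matrix with entries `λ_α r_i(α)` used when the random polynomial is `R`. -/
def evalMatrix (β : A) (R : F[X]) : Matrix A (Fin l) F :=
  fun α i => multiplier A α * (S.r β R i).eval (α : F)

/-- `S` is a canonical random linear repair scheme for `RS(A, k)` over `B`. -/
structure IsRepairScheme (B : Type*) [Field B] [Algebra B F] (k : ℕ) : Prop where
  /-- `R` has degree at most `d` -/
  natDegree_le : ∀ β, ∀ R ∈ (S.law β).support, R.natDegree ≤ S.d
  /-- `R` is fully random: all coefficient vectors (with, possibly, the exception of those for
  which `R(β) = 0`, which are useless for the repair) have positive probability -/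
  mem_support : ∀ β : A, ∀ R : F[X], R.natDegree ≤ S.d → R.eval (β : F) ≠ 0 →
    R ∈ (S.law β).support
  /-- the `r_i` are parity-check polynomials: their degree is at most `n - k - 1` -/
  degree_lt : ∀ β, ∀ R ∈ (S.law β).support, ∀ i,
    (S.r β R i).degree < ((A.card - k : ℕ) : WithBot ℕ)
  /-- `r_i = P_i Q R` at all helper points (`Q` may have a pole at `β`) -/
  r_eval : ∀ β, ∀ R ∈ (S.law β).support, ∀ i, ∀ α : A, α ≠ β →
    (S.r β R i).eval (α : F) = (S.P β i).eval (α : F) * S.Q β α * R.eval (α : F)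
  /-- correctness: unless `R(β) = 0`, the parity checks repair `f(β)` -/
  correct : ∀ β : A, ∀ R ∈ (S.law β).support, R.eval (β : F) ≠ 0 →
    ∃ b, IsEvaluationMatrix B (rsCode A k) β (S.evalMatrix β R) b
  /-- `Q` involves `β`: it is not, up to scalar factors (which a random `R` absorbs anyway), one
  and the same function of the helper point for all `β` -/
  involves : ∃ β β' : A, β ≠ β' ∧
    ¬ ∃ c : F, c ≠ 0 ∧ ∀ α : A, α ≠ β → α ≠ β' → S.Q β α = c * S.Q β' α

/-- The repair bandwidth, in sub-symbols of `B`, for `f(β)`: the largest number of sub-symbols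
downloaded from the helper nodes, over all realizations of the random polynomial. -/
def bandwidth (B : Type*) [Field B] [Algebra B F] (β : A) : ℕ∞ :=
  ⨆ R ∈ (S.law β).support, ((matrixBandwidth B β (S.evalMatrix β R) : ℕ) : ℕ∞)

/-- The joint law of `(β, R)`, where the repaired point `β` is uniform on `A`. -/
def joint [Nonempty A] : PMF (A × F[X]) :=
  (PMF.uniformOfFintype A).bind fun β => (S.law β).map fun R => (β, R)

/-- The event that the nodes in `J` are helper nodes and receive the queries `κ`. -/
def queryEvent (J : Finset A) (κ : A → F) : Set (A × F[X]) :=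
  {ω | ω.1 ∉ J ∧ ∀ α ∈ J, S.query ω.1 ω.2 α = κ α}

/-- `t`-privacy: given the queries received by a set `J` of at most `t` helper nodes, all points
outside `J` are equally likely to be the repaired one. -/
def IsPrivate [Nonempty A] (t : ℕ) : Prop :=
  ∀ J : Finset A, J.card ≤ t → ∀ κ : A → F,
    S.joint.toOuterMeasure (S.queryEvent J κ) ≠ 0 →
    ∀ β' : A, β' ∉ J →
      S.joint.toOuterMeasure ({ω | ω.1 = β'} ∩ S.queryEvent J κ) /
          S.joint.toOuterMeasure (S.queryEvent J κ)
        = 1 / ((A.card - J.card : ℕ) : ℝ≥0∞)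

end CanonicalScheme

section SecretSharing

variable {B : Type*} [Field B] [Algebra B F] [Fintype F]

open Classical in
/-- The subspace polynomial `L_W(x) = ∏_{ω ∈ W} (x - ω)`. -/
def subspacePoly (W : Submodule B F) : F[X] :=
  ∏ ω ∈ Finset.univ.filter (fun ω : F => ω ∈ W), (X - C ω)

/-- The secret-sharing scheme: `r_i(x) = (L_W(u_i (x - β)) / (x - β)) R(x)`, where
`R(x) = R_0 + ⋯ + R_{t-1} x^{t-1}` has independent uniform coefficients. -/
def secretSharing (A : Finset F) {l : ℕ} (W : Submodule B F) (u : Fin l → F) (t : ℕ) :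
    CanonicalScheme A l where
  P := fun β i => (subspacePoly W).comp (C (u i) * (X - C (β : F)))
  Q := fun β α => ((α : F) - (β : F))⁻¹
  d := t - 1
  law := fun _ => (PMF.uniformOfFintype (Fin t → F)).map
    fun a => ∑ s : Fin t, C (a s) * X ^ (s : ℕ)
  r := fun β R i =>
    ((subspacePoly W).comp (C (u i) * (X - C (β : F))) /ₘ (X - C (β : F))) * R

end SecretSharing

end Schemes

end PrivateRepair

end

/-! Lower bound: the realization `R = 1` already costs enough. Its parity checks have degree below
`n - k`, and privacy lowers this to `q ^ m`. If `d` were at most `t - 2`, the queries at `d + 2`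
nodes would reveal the ratios of the values of `Q`, so privacy would make `Q` independent of `β` up
to scalars (`le_d_add_one`). Hence `R` may be a product of `t - 1` linear factors not vanishing at
`β`. The parity check for this `R` is the one for `1` times `R` (`r_eq_mul_of_natDegree_le`), so the
latter has degree below `n - k - (t - 1) = q ^ m`. A nonzero `B`-combination of these checks is a
nonzero polynomial, by correctness at `β`, with fewer than `q ^ m` roots. Counting pairs
(combination, root) bounds the average size of the kernels of the evaluations at the helpers by `q ^
m`. Convexity of `x ↦ q ^ x` bounds their average dimension by `m`, so the average rank is at least
`l - m` (`card_mul_le_sum_finrank`). Attainment: `L_W` is `B`-linear with kernel `W`, so every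
helper row has rank `l - m` or vanishes, while dividing by `x - β` leaves a multiple of the basis
`u` in row `β`. Privacy is Shamir's: at most `t` values of a uniform polynomial of degree below `t`
are jointly uniform. -/

namespace PrivateRepair

/-! ### Average rank of evaluations of low-degree polynomials -/

section Rank

variable {F : Type*} [Field F]

theorem multiplier_ne_zero (A : Finset F) (α : A) : multiplier A α ≠ 0 := by
  classical
  rw [multiplier]
  refine inv_ne_zero (Finset.prod_ne_zero_iff.2 fun γ hγ => sub_ne_zero.2 ?_)
  rintro rfl
  exact absurd hγ (by simp)

variable (B : Type*) [Field B] [Algebra B F]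

theorem finrank_range_comp_linear {ι V V' : Type*} [AddCommGroup V] [Module B V]
    [AddCommGroup V'] [Module B V'] (f : V →ₗ[B] V') (v : ι → V) :
    Set.finrank B (Set.range fun i => f (v i)) =
      Module.finrank B ((Submodule.span B (Set.range v)).map f) := by
  rw [Set.finrank, Submodule.map_span, ← Set.range_comp]
  rfl

theorem finrank_range_mul_left {ι : Type*} {a : F} (ha : a ≠ 0) (v : ι → F) :
    Set.finrank B (Set.range fun i => a * v i) = Set.finrank B (Set.range v) := by
  have h := finrank_range_comp_linear B (LinearMap.mulLeft B a) v
  simp only [LinearMap.mulLeft_apply] at h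
  rw [h, Set.finrank]
  exact (Submodule.equivMapOfInjective (LinearMap.mulLeft B a)
    (by intro x y hxy; simpa [ha] using hxy) _).finrank_eq.symm

variable [Fintype B]

/-- Double count of the pairs `(c, α)` for which the combination with coefficients `c` vanishes at
`α`. -/
theorem sum_card_kernel_le {A : Finset F} {l D : ℕ} (h : Fin l → F[X])
    (hdeg : ∀ i, (h i).degree < (D : WithBot ℕ)) (s : Finset A)
    (hs : s.card = Fintype.card B ^ l - 1)
    (hne : ∀ c : Fin l → B, c ≠ 0 → ∑ i, c i • h i ≠ 0) (hD : 0 < D) :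
    ∑ α ∈ s, Nat.card (LinearMap.ker
      (Fintype.linearCombination B fun i => (h i).eval (α : F))) ≤ s.card * D := by
  classical
  have hroots : ∀ c : Fin l → B, c ≠ 0 →
      (s.filter fun α : A => (∑ i, c i • h i).eval (α : F) = 0).card ≤ D - 1 := by
    intro c hc
    have hd : (∑ i, c i • h i).degree < (D : WithBot ℕ) := by
      refine (degree_sum_le _ _).trans_lt ?_
      rw [Finset.sup_lt_iff (by exact_mod_cast WithBot.bot_lt_coe D)]
      exact fun i _ => (degree_smul_le _ _).trans_lt (hdeg i)
    have hn : (∑ i, c i • h i).natDegree < D :=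
      (natDegree_lt_iff_degree_lt (hne c hc)).2 hd
    refine (Finset.card_le_card_of_injOn (t := (∑ i, c i • h i).roots.toFinset)
      (fun α : A => (α : F)) ?_ Subtype.val_injective.injOn).trans
      ((Multiset.toFinset_card_le _).trans ((card_roots' _).trans (by omega)))
    intro α hα
    simp only [Finset.coe_filter, Set.mem_ofPred_eq] at hα
    simp only [Finset.mem_coe, Multiset.mem_toFinset, mem_roots (hne c hc)]
    exact hα.2
  have hker : ∀ α : A, Nat.card (LinearMap.ker
      (Fintype.linearCombination B fun i => (h i).eval (α : F))) =
      ∑ c : Fin l → B, if (∑ i, c i • h i).eval (α : F) = 0 then 1 else 0 := by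
    intro α
    rw [← Finset.card_filter]
    refine Nat.subtype_card _ fun c => ?_
    simp [Fintype.linearCombination_apply, eval_finsetSum, eval_smul]
  simp_rw [hker]
  -- The zero combination contributes `s.card`; the others, also `s.card` in number, at most `D - 1`
  -- each.
  rw [Finset.sum_comm, ← Finset.add_sum_erase _ _ (Finset.mem_univ (0 : Fin l → B))]
  have h0 : (∑ α ∈ s, if (∑ i, (0 : Fin l → B) i • h i).eval (α : F) = 0 then 1 else 0)
      = s.card := by simp
  have h1 : (∑ c ∈ Finset.univ.erase (0 : Fin l → B), ∑ α ∈ s,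
      if (∑ i, c i • h i).eval (α : F) = 0 then 1 else 0) ≤ s.card * (D - 1) := by
    refine (Finset.sum_le_card_nsmul _ _ (D - 1) fun c hc => ?_).trans (le_of_eq ?_)
    · rw [← Finset.card_filter]
      exact hroots c (Finset.ne_of_mem_erase hc)
    · rw [Finset.card_erase_of_mem (Finset.mem_univ _), hs]
      simp
  rw [h0]
  obtain ⟨D, rfl⟩ : ∃ D', D = D' + 1 := ⟨D - 1, by omega⟩
  simp only [Nat.add_sub_cancel] at h1
  linarith [mul_add s.card D 1]

/-- By convexity `x ↦ q ^ x` lies, at integers, above the line through its points at `m` and `m +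
1`. For `x ≥ m` this is Bernoulli's inequality. -/
theorem pow_tangent_le {q : ℕ} (hq : 2 ≤ q) (x m : ℕ) :
    (q : ℤ) ^ m + ((x : ℤ) - m) * ((q : ℤ) ^ m * (q - 1)) ≤ (q : ℤ) ^ x := by
  have hq' : (2 : ℤ) ≤ q := by exact_mod_cast hq
  rcases le_total m x with hmx | hxm
  · obtain ⟨j, rfl⟩ := Nat.exists_eq_add_of_le hmx
    have hb := one_add_mul_sub_le_pow (show (-1 : ℤ) ≤ q by linarith) j
    have hp : (0 : ℤ) ≤ (q : ℤ) ^ m := by positivity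
    have := mul_le_mul_of_nonneg_left hb hp
    push_cast
    rw [pow_add]
    linarith [this]
  · rcases hxm.eq_or_lt with rfl | hlt
    · simp
    · have h1 : (1 : ℤ) ≤ (m : ℤ) - x := by have := hlt; omega
      have hp : (0 : ℤ) < (q : ℤ) ^ m := by positivity
      have hx : (0 : ℤ) < (q : ℤ) ^ x := by positivity
      nlinarith [mul_le_mul h1 (show (1 : ℤ) ≤ (q : ℤ) - 1 by linarith) (by norm_num)
        (by linarith), mul_pos hp hp]

/-- Polynomials of degree `< q ^ m`, all of whose nontrivial `B`-combinations are nonzero, have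
evaluations of average `B`-rank at least `l - m` on a set of `q ^ l - 1` points. -/
theorem card_mul_le_sum_finrank {A : Finset F} {l m : ℕ} (h : Fin l → F[X])
    (hdeg : ∀ i, (h i).degree < ((Fintype.card B ^ m : ℕ) : WithBot ℕ)) (s : Finset A)
    (hs : s.card = Fintype.card B ^ l - 1)
    (hne : ∀ c : Fin l → B, c ≠ 0 → ∑ i, c i • h i ≠ 0) :
    s.card * (l - m) ≤ ∑ α ∈ s, Set.finrank B (Set.range fun i => (h i).eval (α : F)) := by
  have hq : 2 ≤ Fintype.card B := Fintype.one_lt_card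
  set q := Fintype.card B with hqdef
  have hsum := sum_card_kernel_le B h hdeg s hs hne (by positivity)
  let x : A → ℕ := fun α => Module.finrank B (LinearMap.ker
      (Fintype.linearCombination B fun i => (h i).eval (α : F)))
  have hcard : ∀ α : A, Nat.card (LinearMap.ker
      (Fintype.linearCombination B fun i => (h i).eval (α : F))) = q ^ x α := by
    intro α
    rw [Module.natCard_eq_pow_finrank (K := B), Nat.card_eq_fintype_card]
  simp_rw [hcard] at hsum
  have hrank : ∀ α : A, Set.finrank B (Set.range fun i => (h i).eval (α : F)) + x α = l := by
    intro α
    have := LinearMap.finrank_range_add_finrank_ker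
      (Fintype.linearCombination B fun i => (h i).eval (α : F))
    rw [Fintype.range_linearCombination] at this
    simpa [Set.finrank, x] using this
  -- Summing the chord inequality turns the bound on the average of `q ^ x α` into one on the
  -- average of `x α`.
  have hx : ∑ α ∈ s, ((x α : ℤ) - m) ≤ 0 := by
    have h1 := Finset.sum_le_sum fun α (_ : α ∈ s) => pow_tangent_le hq (x α) m
    rw [Finset.sum_add_distrib, ← Finset.sum_mul, Finset.sum_const, nsmul_eq_mul] at h1
    have h2 : (∑ α ∈ s, (q : ℤ) ^ x α) ≤ s.card * (q : ℤ) ^ m := by exact_mod_cast hsum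
    have hpos : (0 : ℤ) < (q : ℤ) ^ m * (q - 1) := by
      have : (2 : ℤ) ≤ q := by exact_mod_cast hq
      have : (0 : ℤ) < (q : ℤ) - 1 := by linarith
      positivity
    by_contra hcon
    have := mul_pos (not_le.1 hcon) hpos
    linarith
  rw [Finset.sum_sub_distrib, Finset.sum_const, nsmul_eq_mul] at hx
  have hx' : ∑ α ∈ s, x α ≤ s.card * m := by
    have : (∑ α ∈ s, (x α : ℤ)) ≤ s.card * m := by linarith
    exact_mod_cast this
  have htot : ∑ α ∈ s, Set.finrank B (Set.range fun i => (h i).eval (α : F)) + ∑ α ∈ s, x α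
      = s.card * l := by
    rw [← Finset.sum_add_distrib, Finset.sum_congr rfl fun α _ => hrank α]
    simp
  rw [Nat.mul_sub]
  omega

end Rank

/-! ### Lower bound: consequences of privacy -/

theorem natDegree_prod_X_sub_C_subtype {F : Type*} [Field F] {A : Finset F} (J : Finset A) :
    (∏ a ∈ J, (X - C (a : F))).natDegree = J.card := by
  rw [natDegree_prod_of_monic _ _ fun a _ => monic_X_sub_C _]
  simp

theorem eval_prod_X_sub_C_ne_zero {F : Type*} [Field F] {A : Finset F} {J : Finset A} {b : A}
    (hb : b ∉ J) : (∏ a ∈ J, (X - C (a : F))).eval (b : F) ≠ 0 := by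
  rw [eval_prod, Finset.prod_ne_zero_iff]
  rintro a ha
  rw [eval_sub, eval_X, eval_C, sub_ne_zero]
  exact fun h => hb (Subtype.ext h ▸ ha)

theorem eval_prod_X_sub_C_eq_zero {F : Type*} [Field F] {A : Finset F} {J : Finset A} {b : A}
    (hb : b ∈ J) : (∏ a ∈ J, (X - C (a : F))).eval (b : F) = 0 := by
  rw [eval_prod]
  exact Finset.prod_eq_zero hb (by simp)

namespace CanonicalScheme

variable {F : Type*} [Field F] {A : Finset F} {l : ℕ} {S : CanonicalScheme A l}

theorem mem_support_joint [Nonempty A] {β : A} {R : F[X]} :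
    (β, R) ∈ S.joint.support ↔ R ∈ (S.law β).support := by
  rw [joint, PMF.mem_support_bind_iff]
  constructor
  · rintro ⟨γ, -, h⟩
    obtain ⟨R', hR', h⟩ := (PMF.mem_support_map_iff _ _ _).1 h
    rw [Prod.mk.injEq] at h
    obtain ⟨rfl, rfl⟩ := h
    exact hR'
  · exact fun h => ⟨β, PMF.mem_support_uniformOfFintype β,
      (PMF.mem_support_map_iff _ _ _).2 ⟨R, h, rfl⟩⟩

/-- The posterior probability of `β'` is positive, so some realization for `β'` explains the
observed queries. The lower bound uses privacy only through this. -/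
theorem IsPrivate.exists_query_eq [Nonempty A] {t : ℕ} (hS : S.IsPrivate t) {β β' : A}
    {R : F[X]} (hR : R ∈ (S.law β).support) {J : Finset A} (hJ : J.card ≤ t) (hβ : β ∉ J)
    (hβ' : β' ∉ J) :
    ∃ R' ∈ (S.law β').support, ∀ α ∈ J, S.query β' R' α = S.query β R α := by
  have hE : S.joint.toOuterMeasure (S.queryEvent J (S.query β R)) ≠ 0 := by
    rw [Ne, PMF.toOuterMeasure_apply_eq_zero_iff, Set.not_disjoint_iff]
    exact ⟨(β, R), mem_support_joint.2 hR, hβ, fun _ _ => rfl⟩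
  have h := hS J hJ _ hE β' hβ'
  have h0 : S.joint.toOuterMeasure ({ω | ω.1 = β'} ∩ S.queryEvent J (S.query β R)) ≠ 0 := by
    intro h0
    rw [h0, ENNReal.zero_div] at h
    exact (ENNReal.div_ne_zero.2 ⟨one_ne_zero, ENNReal.natCast_ne_top _⟩) h.symm
  rw [Ne, PMF.toOuterMeasure_apply_eq_zero_iff, Set.not_disjoint_iff] at h0
  obtain ⟨⟨γ, R'⟩, hsupp, hγ, -, hq⟩ := h0
  obtain rfl : γ = β' := hγ
  exact ⟨R', mem_support_joint.1 hsupp, hq⟩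

namespace IsRepairScheme

variable {B : Type*} [Field B] [Algebra B F] {k : ℕ}

theorem one_mem_support (hS : S.IsRepairScheme B k) (β : A) : (1 : F[X]) ∈ (S.law β).support :=
  hS.mem_support β 1 (by simp) (by simp)

theorem linearIndependent_eval (hS : S.IsRepairScheme B k) (β : A) :
    LinearIndependent B fun i => (S.r β 1 i).eval (β : F) := by
  obtain ⟨b, hb⟩ := hS.correct β 1 (hS.one_mem_support β) (by simp)
  have h := hb.rank_eq
  unfold evalMatrix at h
  rw [finrank_range_mul_left B (multiplier_ne_zero A β)] at h
  rw [linearIndependent_iff_card_eq_finrank_span, Fintype.card_fin, h]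

theorem eval_r_one (hS : S.IsRepairScheme B k) {β α : A} (h : α ≠ β) (i : Fin l) :
    (S.r β 1 i).eval (α : F) = (S.P β i).eval (α : F) * S.Q β α := by
  rw [hS.r_eval β 1 (hS.one_mem_support β) i α h, eval_one, mul_one]

/-- Zeros of `Q` are roots of a parity check for `R = 1`, which is nonzero at `β`. -/
theorem card_Q_eq_zero_lt [DecidableEq F] (hS : S.IsRepairScheme B k) (hl : 0 < l) (β : A) :
    (Finset.univ.filter fun α : A => α ≠ β ∧ S.Q β α = 0).card < A.card - k := by
  have hne : S.r β 1 ⟨0, hl⟩ ≠ 0 := by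
    intro h
    have := (hS.linearIndependent_eval β).ne_zero ⟨0, hl⟩
    simp [h] at this
  have hd : (S.r β 1 ⟨0, hl⟩).natDegree < A.card - k :=
    (natDegree_lt_iff_degree_lt hne).2 (hS.degree_lt β 1 (hS.one_mem_support β) _)
  refine lt_of_le_of_lt ?_ hd
  refine (Finset.card_le_card_of_injOn (t := (S.r β 1 ⟨0, hl⟩).roots.toFinset)
    (fun α : A => (α : F)) ?_ Subtype.val_injective.injOn).trans
    ((Multiset.toFinset_card_le _).trans (card_roots' _))
  intro α hα
  simp only [Finset.coe_filter, Set.mem_ofPred_eq, Finset.mem_univ, true_and] at hα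
  simp only [Finset.mem_coe, Multiset.mem_toFinset, mem_roots hne, IsRoot.def]
  rw [hS.eval_r_one hα.1, hα.2, mul_zero]

theorem Q_ne_zero_of_isPrivate [Nonempty A] {t : ℕ} (hS : S.IsRepairScheme B k)
    (hp : S.IsPrivate t) (ht : 1 ≤ t) {β β' α : A} (h : α ≠ β) (h' : α ≠ β')
    (hQ : S.Q β α ≠ 0) : S.Q β' α ≠ 0 := by
  obtain ⟨R', -, hR'⟩ := hp.exists_query_eq (hS.one_mem_support β) (J := {α}) (β' := β')
    (by simpa using ht) (by simpa using h.symm) (by simpa using h'.symm)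
  have := hR' α (by simp)
  intro h0
  simp [query, h0] at this
  exact hQ this.symm

/-- If `R` had degree at most `t - 2`, queries at `d + 2` points would determine the private
function up to a scalar factor, contradicting privacy. -/
theorem le_d_add_one [Nonempty A] {t : ℕ} (hS : S.IsRepairScheme B k)
    (hp : S.IsPrivate t) (hl : 0 < l) (htk : t < k) : t ≤ S.d + 1 := by
  classical
  by_contra! hlt
  obtain ⟨β, β', hββ', hinv⟩ := hS.involves
  apply hinv
  set N := Finset.univ.filter fun α : A => (α ≠ β ∧ α ≠ β') ∧ S.Q β α ≠ 0 with hN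
  -- Fewer than `n - k` zeros of `Q` and the two points `β`, `β'` are lost, leaving at least `k - 1
  -- ≥ t ≥ d + 2`.
  have hNcard : S.d + 2 ≤ N.card := by
    have hz := hS.card_Q_eq_zero_lt hl β
    have hcover : (Finset.univ : Finset A) ⊆ N ∪
        (({β, β'} : Finset A) ∪ Finset.univ.filter fun α : A => α ≠ β ∧ S.Q β α = 0) := by
      intro α _
      simp only [hN, Finset.mem_union, Finset.mem_filter, Finset.mem_univ, true_and,
        Finset.mem_insert, Finset.mem_singleton]
      tauto
    have h1 := (Finset.card_le_card hcover).trans (Finset.card_union_le _ _)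
    have h2 := Finset.card_union_le ({β, β'} : Finset A)
      (Finset.univ.filter fun α : A => α ≠ β ∧ S.Q β α = 0)
    rw [Finset.card_pair hββ'] at h2
    rw [Finset.card_univ, Fintype.card_coe] at h1
    omega
  have hmem : ∀ α ∈ N, (α ≠ β ∧ α ≠ β') ∧ S.Q β α ≠ 0 := fun α hα => by simpa [hN] using hα
  have hratio : ∀ b ∈ N, ∀ c ∈ N, b ≠ c → S.Q β b * S.Q β' c = S.Q β c * S.Q β' b := by
    intro b hb c hc hbc
    obtain ⟨J, hbcJ, hJN, hJ⟩ := Finset.exists_subsuperset_card_eq (n := S.d + 2)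
      (show ({b, c} : Finset A) ⊆ N by simp [Finset.insert_subset_iff, hb, hc])
      (by rw [Finset.card_pair hbc]; omega) hNcard
    have hbJ : b ∈ J := hbcJ (by simp)
    have hcJ : c ∈ J := hbcJ (by simp)
    set I := (J.erase c).erase b with hI
    have hbI : b ∈ J.erase c := Finset.mem_erase.2 ⟨hbc, hbJ⟩
    have hIcard : I.card = S.d := by
      rw [hI, Finset.card_erase_of_mem hbI, Finset.card_erase_of_mem hcJ, hJ]; rfl
    have hβJ : β ∉ J := fun h => (hmem β (hJN h)).1.1 rfl
    have hβ'J : β' ∉ J := fun h => (hmem β' (hJN h)).1.2 rfl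
    -- This `R` vanishes at `d` of the `d + 2` observed nodes, which fixes the matching `R'` up to a
    -- scalar; the queries at `b` and `c` then compare the two functions `Q`.
    set R : F[X] := ∏ a ∈ I, (X - C (a : F)) with hRdef
    have hRdeg : R.natDegree = S.d := by rw [hRdef, natDegree_prod_X_sub_C_subtype, hIcard]
    have hRsupp : R ∈ (S.law β).support := hS.mem_support β R hRdeg.le
      (eval_prod_X_sub_C_ne_zero fun h =>
        hβJ (Finset.mem_of_mem_erase (Finset.mem_of_mem_erase h)))
    have hRb : R.eval (b : F) ≠ 0 := eval_prod_X_sub_C_ne_zero (by simp [hI])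
    have hRc : R.eval (c : F) ≠ 0 := eval_prod_X_sub_C_ne_zero (by simp [hI])
    obtain ⟨R', hR'supp, hR'⟩ := hp.exists_query_eq hRsupp (J := J) (by omega) hβJ hβ'J
    simp only [query] at hR'
    set e := R'.eval (b : F) / R.eval (b : F) with he
    -- Degree at most `d`, but `d + 1` zeros: `b` by the choice of `e`, and the points of `I`, where
    -- a zero query forces `R'` to vanish since `Q β'` does not.
    have hzero : R' - C e * R = 0 := by
      refine Polynomial.eq_zero_of_degree_lt_of_eval_index_eq_zero (s := J.erase c)
        (v := fun a : A => (a : F)) Subtype.val_injective.injOn ?_ ?_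
      · rw [Finset.card_erase_of_mem hcJ, hJ]
        refine lt_of_le_of_lt (degree_le_of_natDegree_le (n := S.d) ?_)
          (by exact_mod_cast Nat.lt_succ_self _)
        exact (natDegree_sub_le _ _).trans (max_le (hS.natDegree_le β' R' hR'supp)
          ((natDegree_C_mul_le _ _).trans hRdeg.le))
      · intro a ha
        rw [eval_sub, eval_mul, eval_C]
        by_cases hab : a = b
        · rw [hab, he, div_mul_cancel₀ _ hRb, sub_self]
        · have haJ := Finset.mem_of_mem_erase ha
          have hRa : R.eval (a : F) = 0 :=
            eval_prod_X_sub_C_eq_zero (Finset.mem_erase.2 ⟨hab, ha⟩)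
          have ha' := hmem a (hJN haJ)
          have := hR' a haJ
          rw [hRa, mul_zero, mul_eq_zero] at this
          rw [this.resolve_left (hS.Q_ne_zero_of_isPrivate hp (by omega) ha'.1.1 ha'.1.2 ha'.2),
            hRa, mul_zero, sub_zero]
    rw [sub_eq_zero] at hzero
    have key : ∀ a ∈ J, R.eval (a : F) ≠ 0 → S.Q β' a * e = S.Q β a := by
      intro a ha hRa
      have := hR' a ha
      rw [hzero, eval_mul, eval_C, ← mul_assoc] at this
      exact mul_right_cancel₀ hRa this
    rw [← key b hbJ hRb, ← key c hcJ hRc]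
    ring
  obtain ⟨b, hb⟩ : N.Nonempty := Finset.card_pos.1 (by omega)
  have hb' := hmem b hb
  have hQ'b := hS.Q_ne_zero_of_isPrivate hp (by omega) hb'.1.1 hb'.1.2 hb'.2
  refine ⟨S.Q β b / S.Q β' b, div_ne_zero hb'.2 hQ'b, fun α hα hα' => ?_⟩
  by_cases hQ : S.Q β α = 0
  · have : S.Q β' α = 0 := by
      by_contra h
      exact hS.Q_ne_zero_of_isPrivate hp (by omega) hα' hα h hQ
    rw [hQ, this, mul_zero]
  · have hαN : α ∈ N := by simp [hN, hα, hα', hQ]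
    by_cases hαb : α = b
    · rw [hαb, div_mul_cancel₀ _ hQ'b]
    · rw [div_mul_eq_mul_div, eq_div_iff hQ'b]
      exact hratio α hαN b hb hαb

/-- Both sides have degree below `n - 1` and agree at the `n - 1` helper points. -/
theorem r_eq_mul_of_natDegree_le (hS : S.IsRepairScheme B k) (β : A) {R : F[X]}
    (hR : R ∈ (S.law β).support) (i : Fin l)
    (hdeg : A.card - k + R.natDegree ≤ A.card - 1) : S.r β R i = S.r β 1 i * R := by
  classical
  have hcard : (Finset.univ.erase β : Finset A).card = A.card - 1 := by
    rw [Finset.card_erase_of_mem (Finset.mem_univ _), Finset.card_univ, Fintype.card_coe]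
  refine Polynomial.eq_of_degrees_lt_of_eval_index_eq (s := Finset.univ.erase β)
    (v := fun a : A => (a : F)) Subtype.val_injective.injOn ?_ ?_ ?_
  · rw [hcard]
    exact (hS.degree_lt β R hR i).trans_le (by exact_mod_cast (by omega))
  · rw [hcard]
    by_cases h0 : S.r β 1 i * R = 0
    · rw [h0, degree_zero]; exact WithBot.bot_lt_coe _
    · have h1 := left_ne_zero_of_mul h0
      have := (natDegree_lt_iff_degree_lt h1).2 (hS.degree_lt β 1 (hS.one_mem_support β) i)
      rw [← natDegree_lt_iff_degree_lt h0, natDegree_mul h1 (right_ne_zero_of_mul h0)]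
      omega
  · intro α hα
    have hαβ := Finset.ne_of_mem_erase hα
    rw [hS.r_eval β R hR i α hαβ, eval_mul, hS.eval_r_one hαβ]

/-- Multiplying by `t - 1` linear factors still gives a parity check, of degree below `n - k = D + t
- 1`. -/
theorem degree_r_one_lt [Nonempty A] {t D : ℕ} (hS : S.IsRepairScheme B k)
    (hp : S.IsPrivate t) (hl : 0 < l) (ht : 1 ≤ t) (htk : t < k)
    (hn : A.card = D + k + t - 1) (hD : 0 < D) (β : A) (i : Fin l) :
    (S.r β 1 i).degree < (D : WithBot ℕ) := by
  classical
  have hd := hS.le_d_add_one hp hl htk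
  have hcard : (Finset.univ.erase β : Finset A).card = A.card - 1 := by
    rw [Finset.card_erase_of_mem (Finset.mem_univ _), Finset.card_univ, Fintype.card_coe]
  obtain ⟨Z, hZ, hZcard⟩ := Finset.exists_subset_card_eq
    (s := (Finset.univ.erase β : Finset A)) (n := t - 1) (by omega)
  have hdeg := natDegree_prod_X_sub_C_subtype Z
  rw [hZcard] at hdeg
  have hβZ : β ∉ Z := fun h => Finset.ne_of_mem_erase (hZ h) rfl
  have hsupp := hS.mem_support β _ (hdeg.le.trans (by omega)) (eval_prod_X_sub_C_ne_zero hβZ)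
  have hr := hS.r_eq_mul_of_natDegree_le β hsupp i (by omega)
  by_cases h0 : S.r β 1 i = 0
  · rw [h0, degree_zero]; exact WithBot.bot_lt_coe _
  · have hR0 : (∏ a ∈ Z, (X - C (a : F))) ≠ 0 :=
      Finset.prod_ne_zero_iff.2 fun a _ => X_sub_C_ne_zero _
    have h1 := hS.degree_lt β _ hsupp i
    rw [hr, ← natDegree_lt_iff_degree_lt (mul_ne_zero h0 hR0), natDegree_mul h0 hR0,
      hdeg] at h1
    rw [← natDegree_lt_iff_degree_lt h0]
    omega

end IsRepairScheme

theorem matrixBandwidth_evalMatrix {B : Type*} [Field B] [Algebra B F] [DecidableEq A] (β : A)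
    (R : F[X]) : matrixBandwidth B β (S.evalMatrix β R) =
      ∑ α ∈ Finset.univ.erase β, Set.finrank B (Set.range fun i => (S.r β R i).eval (α : F)) := by
  rw [matrixBandwidth]
  refine Finset.sum_congr (by congr!) fun α _ => ?_
  exact finrank_range_mul_left B (multiplier_ne_zero A α) _

theorem IsRepairScheme.le_bandwidth [Nonempty A] {B : Type*} [Field B] [Fintype B] [Algebra B F]
    {k t m : ℕ} (hS : S.IsRepairScheme B k) (hp : S.IsPrivate t) (ht : 1 ≤ t) (htk : t < k)
    (hA : A.card = Fintype.card B ^ l) (hn : A.card = Fintype.card B ^ m + k + t - 1) (β : A) :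
    (((A.card - 1) * (l - m) : ℕ) : ℕ∞) ≤ S.bandwidth B β := by
  classical
  have hD : 0 < Fintype.card B ^ m := by have := Fintype.card_pos (α := B); positivity
  have hl : 0 < l := by
    rcases Nat.eq_zero_or_pos l with rfl | h
    · rw [pow_zero] at hA; omega
    · exact h
  have hcard : (Finset.univ.erase β : Finset A).card = A.card - 1 := by
    rw [Finset.card_erase_of_mem (Finset.mem_univ _), Finset.card_univ, Fintype.card_coe]
  -- The bandwidth is a maximum, so one realization suffices.
  refine le_iSup₂_of_le (1 : F[X]) (hS.one_mem_support β) ?_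
  rw [matrixBandwidth_evalMatrix, ← hcard]
  exact_mod_cast card_mul_le_sum_finrank B (S.r β 1)
    (hS.degree_r_one_lt hp hl ht htk hn hD β) (Finset.univ.erase β) (by rw [hcard, hA]) (by
      intro c hc h
      have h' := congrArg (eval (β : F)) h
      rw [eval_finsetSum, eval_zero] at h'
      simp only [eval_smul] at h'
      exact hc (funext (Fintype.linearIndependent_iff.1 (hS.linearIndependent_eval β) c h')))

end CanonicalScheme

/-! ### Attainment: dual codewords and subspace polynomials -/

theorem natDegree_lt_iff_degree_lt_of_pos {R : Type*} [Semiring R] {p : R[X]} {n : ℕ}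
    (hn : 0 < n) : p.natDegree < n ↔ p.degree < (n : WithBot ℕ) := by
  rcases eq_or_ne p 0 with rfl | hp
  · simp [hn]
  · exact natDegree_lt_iff_degree_lt hp

/-- By Lagrange interpolation the pairing with `f` is the coefficient of `X ^ (n - 1)` in `f * r`,
whose degree is at most `n - 2`. -/
theorem mem_dualCode_rsCode {F : Type*} [Field F] {A : Finset F} {k : ℕ} {r : F[X]}
    (hr : r.degree < ((A.card - k : ℕ) : WithBot ℕ)) :
    (fun α : A => multiplier A α * r.eval (α : F)) ∈ dualCode (rsCode A k) := by
  classical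
  rintro c ⟨f, hf, rfl⟩
  have hf' : f.degree < (k : WithBot ℕ) := Polynomial.mem_degreeLT.1 hf
  by_cases h0 : f * r = 0
  · refine Finset.sum_eq_zero fun α _ => ?_
    have := congrArg (eval (α : F)) h0
    rw [eval_mul, eval_zero] at this
    simp only [LinearMap.pi_apply, leval_apply]
    rw [mul_left_comm, this, mul_zero]
  · have h1 := (natDegree_lt_iff_degree_lt (left_ne_zero_of_mul h0)).2 hf'
    have h2 := (natDegree_lt_iff_degree_lt (right_ne_zero_of_mul h0)).2 hr
    have hd : (f * r).natDegree < A.card - 1 := by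
      rw [natDegree_mul (left_ne_zero_of_mul h0) (right_ne_zero_of_mul h0)]
      omega
    have h := Lagrange.coeff_eq_sum (s := A) (v := id) Function.injective_id.injOn (P := f * r)
      ((natDegree_lt_iff_degree_lt h0).1 (by omega))
    rw [coeff_eq_zero_of_natDegree_lt hd, ← Finset.sum_coe_sort] at h
    rw [h]
    refine Finset.sum_congr rfl fun α _ => ?_
    simp only [LinearMap.pi_apply, leval_apply, multiplier, id, eval_mul, div_eq_mul_inv]
    ring

section SubspacePoly

variable {B F : Type*} [Field B] [Field F] [Algebra B F] [Fintype F] (W : Submodule B F)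

open Classical in
theorem eval_subspacePoly (x : F) : (subspacePoly W).eval x = ∏ ω : W, (x - ω) := by
  rw [subspacePoly, eval_prod]
  simp only [eval_sub, eval_X, eval_C]
  exact Finset.prod_subtype _ (fun ω => by simp) _

theorem eval_subspacePoly_eq_zero {x : F} : (subspacePoly W).eval x = 0 ↔ x ∈ W := by
  classical
  rw [eval_subspacePoly, Finset.prod_eq_zero_iff]
  constructor
  · rintro ⟨ω, -, h⟩
    rw [sub_eq_zero.1 h]
    exact ω.2
  · exact fun h => ⟨⟨x, h⟩, Finset.mem_univ _, sub_self _⟩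

theorem monic_subspacePoly : (subspacePoly W).Monic :=
  monic_prod_of_monic _ _ fun _ _ => monic_X_sub_C _

theorem natDegree_subspacePoly : (subspacePoly W).natDegree = Nat.card W := by
  classical
  rw [subspacePoly, natDegree_prod_of_monic _ _ fun a _ => monic_X_sub_C _]
  simp only [natDegree_X_sub_C, Finset.sum_const, smul_eq_mul, mul_one]
  exact (Nat.subtype_card _ fun c => by simp).symm

/-- For fixed `y` the defect of additivity is a polynomial in `x` of degree below `|W|` (leading
terms cancel). It vanishes on `W`, as translation by `ω ∈ W` permutes the factors. -/
theorem eval_subspacePoly_add (x y : F) : (subspacePoly W).eval (x + y) =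
    (subspacePoly W).eval x + (subspacePoly W).eval y := by
  classical
  set p := subspacePoly W with hp
  have hpm : p.Monic := monic_subspacePoly W
  have hcard : 0 < Nat.card W := Nat.card_pos
  have hpd : p.degree = (Nat.card W : ℕ) := by
    rw [degree_eq_natDegree hpm.ne_zero, hp, natDegree_subspacePoly]
  have htr : ∀ ω : W, p.eval ((ω : F) + y) = p.eval y := by
    intro ω
    rw [hp, eval_subspacePoly, eval_subspacePoly]
    refine Fintype.prod_equiv (Equiv.subRight ω) _ _ fun a => ?_
    simp only [Equiv.subRight_apply, AddSubgroupClass.coe_sub]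
    ring
  have hzero : p.comp (X + C y) - p - C (p.eval y) = 0 := by
    refine Polynomial.eq_zero_of_degree_lt_of_eval_index_eq_zero (s := Finset.univ)
      (v := fun a : W => (a : F)) Subtype.val_injective.injOn ?_ ?_
    · rw [Finset.card_univ, ← Nat.card_eq_fintype_card, ← hpd]
      refine (degree_sub_le _ _).trans_lt (max_lt ?_ ?_)
      · have hcm : (p.comp (X + C y)).Monic := hpm.comp_X_add_C y
        have hdeg : (p.comp (X + C y)).degree = p.degree := by
          rw [degree_eq_natDegree hcm.ne_zero, degree_eq_natDegree hpm.ne_zero, natDegree_comp,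
            natDegree_X_add_C, mul_one]
        have := degree_sub_lt_left hdeg hcm.ne_zero (by rw [hcm.leadingCoeff, hpm.leadingCoeff])
        rwa [hdeg] at this
      · refine degree_C_le.trans_lt ?_
        rw [hpd]
        exact_mod_cast hcard
    · intro ω _
      simp only [eval_sub, eval_comp, eval_add, eval_X, eval_C]
      rw [htr ω, hp, (eval_subspacePoly_eq_zero W).2 ω.2]
      ring
  have h := congrArg (eval x) hzero
  simp only [eval_sub, eval_comp, eval_add, eval_X, eval_C, eval_zero] at h
  linear_combination h

/-- Scaling permutes `W`, so a factor `b ^ |W|` comes out; it equals `b` because `|W|` is a power of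
`|B|`. -/
theorem eval_subspacePoly_smul [Fintype B] (b : B) (x : F) :
    (subspacePoly W).eval (b • x) = b • (subspacePoly W).eval x := by
  classical
  rcases eq_or_ne b 0 with rfl | hb
  · rw [zero_smul, zero_smul, eval_subspacePoly_eq_zero]
    exact W.zero_mem
  · rw [eval_subspacePoly, eval_subspacePoly]
    have h : ∏ ω : W, (b • x - (ω : F)) = ∏ ω : W, b • (x - (ω : F)) :=
      (Fintype.prod_equiv (LinearEquiv.smulOfNeZero B W b hb).toEquiv _ _ fun ω => by
        simp [smul_sub]).symm
    rw [h, Finset.prod_smul, Finset.prod_const, Finset.card_univ,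
      Module.card_eq_pow_finrank (K := B), FiniteField.pow_card_pow]

/-- The `B`-linear map given by evaluation of the subspace polynomial. -/
noncomputable def subspaceMap [Fintype B] : F →ₗ[B] F where
  toFun x := (subspacePoly W).eval x
  map_add' := eval_subspacePoly_add W
  map_smul' := eval_subspacePoly_smul W

theorem finrank_range_subspaceMap [Fintype B] :
    Module.finrank B (LinearMap.range (subspaceMap W)) =
      Module.finrank B F - Module.finrank B W := by
  have hker : LinearMap.ker (subspaceMap W) = W := by
    ext x
    exact eval_subspacePoly_eq_zero W
  have := LinearMap.finrank_range_add_finrank_ker (subspaceMap W)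
  rw [hker] at this
  omega

/-- The `u i * a` again span `F`, so the values span the whole image of `subspaceMap W`. -/
theorem finrank_range_eval_subspacePoly [Fintype B] {l : ℕ} (u : Module.Basis (Fin l) B F)
    {a : F} (ha : a ≠ 0) :
    Set.finrank B (Set.range fun i => (subspacePoly W).eval (u i * a)) =
      Module.finrank B F - Module.finrank B W := by
  have h := finrank_range_comp_linear B (subspaceMap W) fun i => LinearMap.mulRight B a (u i)
  have hsurj : LinearMap.range (LinearMap.mulRight B a) = ⊤ := by
    rw [LinearMap.range_eq_top]
    exact fun y => ⟨y * a⁻¹, by simp [ha]⟩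
  have hspan : Submodule.span B (Set.range fun i => LinearMap.mulRight B a (u i)) = ⊤ := by
    rw [show (fun i => LinearMap.mulRight B a (u i)) = LinearMap.mulRight B a ∘ u from rfl,
      Set.range_comp, ← Submodule.map_span, u.span_eq, Submodule.map_top, hsurj]
  rw [hspan, Submodule.map_top, finrank_range_subspaceMap] at h
  exact h

/-- Zero is a simple root; `G` is the cofactor that survives division by `x - β`. -/
theorem exists_subspacePoly_eq_X_mul : ∃ G : F[X], subspacePoly W = X * G ∧
    G.eval 0 ≠ 0 ∧ G.natDegree = Nat.card W - 1 := by
  obtain ⟨G, hG⟩ : X ∣ subspacePoly W := by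
    rw [X_dvd_iff, coeff_zero_eq_eval_zero, eval_subspacePoly_eq_zero]
    exact W.zero_mem
  have hG0 : G ≠ 0 := by
    rintro rfl
    exact (monic_subspacePoly W).ne_zero (by rw [hG, mul_zero])
  refine ⟨G, hG, ?_, ?_⟩
  · classical
    have h : subspacePoly W = X * ∏ ω ∈ (Finset.univ.filter fun ω : F => ω ∈ W).erase 0,
        (X - C ω) := by
      rw [subspacePoly, ← Finset.mul_prod_erase _ _
        (show (0 : F) ∈ Finset.univ.filter fun ω : F => ω ∈ W by simp)]
      simp
    rw [mul_left_cancel₀ X_ne_zero (hG.symm.trans h), eval_prod, Finset.prod_ne_zero_iff]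
    intro ω hω
    simpa using Finset.ne_of_mem_erase hω
  · rw [← natDegree_subspacePoly, hG, natDegree_X_mul hG0, Nat.add_sub_cancel]

end SubspacePoly

/-! ### Random polynomials and a criterion for privacy -/

section CoeffPoly

variable {F : Type*} [Field F] {t : ℕ}

/-- The polynomial with coefficient vector `a`. -/
noncomputable def coeffPoly (a : Fin t → F) : F[X] := ∑ s : Fin t, C (a s) * X ^ (s : ℕ)

theorem degree_coeffPoly_lt (a : Fin t → F) : (coeffPoly a).degree < (t : WithBot ℕ) := by
  refine (degree_sum_le _ _).trans_lt ?_
  rw [Finset.sup_lt_iff (by exact_mod_cast WithBot.bot_lt_coe t)]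
  exact fun s _ => (degree_C_mul_X_pow_le _ _).trans_lt (by exact_mod_cast s.2)

theorem exists_coeffPoly_eq {R : F[X]} (hR : R.degree < (t : WithBot ℕ)) :
    ∃ a : Fin t → F, coeffPoly a = R := by
  refine ⟨fun s => R.coeff s, ?_⟩
  rw [coeffPoly, Fin.sum_univ_eq_sum_range (fun s => C (R.coeff s) * X ^ s) t]
  rcases Nat.eq_zero_or_pos t with rfl | ht
  · rw [Finset.sum_range_zero]
    exact (degree_eq_bot.1 (by simpa [Nat.WithBot.lt_zero_iff] using hR)).symm
  · exact (as_sum_range_C_mul_X_pow' R ((natDegree_lt_iff_degree_lt_of_pos ht).2 hR)).symm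

theorem eval_coeffPoly_sub (a b : Fin t → F) (x : F) :
    (coeffPoly (a - b)).eval x = (coeffPoly a).eval x - (coeffPoly b).eval x := by
  simp only [coeffPoly, Pi.sub_apply, map_sub, sub_mul, Finset.sum_sub_distrib, eval_sub]

/-- Evaluations of uniformly random polynomials of degree `< t` at no more than `t` points are
uniformly distributed. -/
theorem toOuterMeasure_eval_coeffPoly_eq [Fintype F] {A : Finset F} {J : Finset A}
    (hJ : J.card ≤ t) (v : A → F) :
    ((PMF.uniformOfFintype (Fin t → F)).map coeffPoly).toOuterMeasure
        {R | ∀ α ∈ J, R.eval (α : F) = v α} =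
      ((PMF.uniformOfFintype (Fin t → F)).map coeffPoly).toOuterMeasure
        {R | ∀ α ∈ J, R.eval (α : F) = 0} := by
  classical
  have hinj : Set.InjOn (fun α : A => (α : F)) J := Subtype.val_injective.injOn
  obtain ⟨a₀, ha₀⟩ := exists_coeffPoly_eq (t := t)
    ((Lagrange.degree_interpolate_lt (s := J) (v := fun α : A => (α : F)) v hinj).trans_le
      (by exact_mod_cast hJ))
  have hev : ∀ α ∈ J, (coeffPoly a₀).eval (α : F) = v α := fun α hα => by
    rw [ha₀]
    exact Lagrange.eval_interpolate_at_node v hinj hα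
  rw [PMF.toOuterMeasure_map_apply, PMF.toOuterMeasure_map_apply,
    PMF.toOuterMeasure_uniformOfFintype_apply, PMF.toOuterMeasure_uniformOfFintype_apply]
  congr 2
  -- Subtracting the interpolant `a₀` carries the solutions with values `v` to those with values
  -- `0`.
  refine Fintype.card_congr (Equiv.subtypeEquiv (Equiv.subRight a₀) fun a => ?_)
  refine forall₂_congr fun α hα => ?_
  rw [Equiv.subRight_apply, eval_coeffPoly_sub, hev α hα, sub_eq_zero]

end CoeffPoly

namespace CanonicalScheme

variable {F : Type*} [Field F] {A : Finset F} {l : ℕ} {S : CanonicalScheme A l}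

theorem toOuterMeasure_joint [Nonempty A] (E : Set (A × F[X])) :
    S.joint.toOuterMeasure E =
      ∑ β, (A.card : ℝ≥0∞)⁻¹ * (S.law β).toOuterMeasure {R | (β, R) ∈ E} := by
  rw [joint, PMF.toOuterMeasure_bind_apply, tsum_fintype]
  refine Finset.sum_congr rfl fun β _ => ?_
  rw [PMF.toOuterMeasure_map_apply, PMF.uniformOfFintype_apply, Fintype.card_coe]
  rfl

/-- Bayes: equal likelihoods under a uniform prior give a uniform posterior on the complement of
`J`. -/
theorem isPrivate_of_toOuterMeasure_eq [Nonempty A] {t : ℕ}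
    (h : ∀ J : Finset A, J.card ≤ t → ∀ κ : A → F, ∃ c : ℝ≥0∞, c ≠ ∞ ∧ ∀ β ∉ J,
      (S.law β).toOuterMeasure {R | ∀ α ∈ J, S.query β R α = κ α} = c) : S.IsPrivate t := by
  classical
  intro J hJ κ hE β' hβ'
  obtain ⟨c, hc, hcβ⟩ := h J hJ κ
  set w := (A.card : ℝ≥0∞)⁻¹ * c with hw
  have hin : ∀ β ∈ J, {R | (β, R) ∈ S.queryEvent J κ} = ∅ := by
    intro β hβ
    ext R
    simp [queryEvent, hβ]
  have hout : ∀ β ∉ J, {R | (β, R) ∈ S.queryEvent J κ} =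
      {R | ∀ α ∈ J, S.query β R α = κ α} := by
    intro β hβ
    ext R
    simp [queryEvent, hβ]
  have hterm : ∀ β, (A.card : ℝ≥0∞)⁻¹ * (S.law β).toOuterMeasure
      {R | (β, R) ∈ S.queryEvent J κ} = if β ∈ Jᶜ then w else 0 := by
    intro β
    by_cases hβ : β ∈ J
    · rw [hin β hβ]
      simp [hβ]
    · rw [hout β hβ, hcβ β hβ]
      simp [hβ, hw]
  have htotal : S.joint.toOuterMeasure (S.queryEvent J κ) = ((A.card - J.card : ℕ) : ℝ≥0∞) * w := by
    rw [toOuterMeasure_joint, Finset.sum_congr rfl fun β _ => hterm β, Finset.sum_ite_mem,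
      Finset.univ_inter, Finset.sum_const, Finset.card_compl, Fintype.card_coe, nsmul_eq_mul]
  have hsingle : S.joint.toOuterMeasure ({ω | ω.1 = β'} ∩ S.queryEvent J κ) = w := by
    rw [toOuterMeasure_joint, Finset.sum_eq_single β']
    · rw [show {R | (β', R) ∈ ({ω | ω.1 = β'} ∩ S.queryEvent J κ : Set (A × F[X]))} =
        {R | (β', R) ∈ S.queryEvent J κ} by ext R; simp, hterm β']
      simp [hβ']
    · intro β _ hβ
      rw [show {R | (β, R) ∈ ({ω | ω.1 = β'} ∩ S.queryEvent J κ : Set (A × F[X]))} = ∅ by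
        ext R; simp [hβ]]
      simp
    · simp
  rw [htotal] at hE ⊢
  rw [hsingle]
  have hw0 : w ≠ 0 := right_ne_zero_of_mul hE
  have hA : (A.card : ℝ≥0∞) ≠ 0 := by
    rw [Nat.cast_ne_zero, ← Fintype.card_coe]
    exact Fintype.card_ne_zero
  have hwt : w ≠ ∞ := ENNReal.mul_ne_top (ENNReal.inv_ne_top.2 hA) hc
  simpa only [one_mul] using ENNReal.mul_div_mul_right 1 ((A.card - J.card : ℕ) : ℝ≥0∞) hw0 hwt

end CanonicalScheme

/-! ### The secret-sharing scheme -/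

section SecretSharing

variable {B F : Type*} [Field B] [Field F] [Algebra B F] [Fintype F] {A : Finset F} {l t : ℕ}
  {W : Submodule B F} {u : Fin l → F}

theorem law_secretSharing (β : A) : (secretSharing A W u t).law β =
    (PMF.uniformOfFintype (Fin t → F)).map coeffPoly := rfl

theorem mem_support_law_secretSharing {β : A} {R : F[X]} :
    R ∈ ((secretSharing A W u t).law β).support ↔ R.degree < (t : WithBot ℕ) := by
  rw [law_secretSharing, PMF.mem_support_map_iff]
  constructor
  · rintro ⟨a, -, rfl⟩
    exact degree_coeffPoly_lt a
  · intro hR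
    obtain ⟨a, rfl⟩ := exists_coeffPoly_eq hR
    exact ⟨a, PMF.mem_support_uniformOfFintype a, rfl⟩

theorem subspacePoly_comp_divByMonic {G : F[X]} (hG : subspacePoly W = X * G) (a b : F) :
    (subspacePoly W).comp (C a * (X - C b)) /ₘ (X - C b) =
      C a * G.comp (C a * (X - C b)) := by
  rw [hG, mul_comp, X_comp, mul_comm (C a) (X - C b), mul_assoc,
    mul_divByMonic_cancel_left _ (monic_X_sub_C b)]

theorem eval_r_secretSharing {β α : A} (h : α ≠ β) (R : F[X]) (i : Fin l) :
    ((secretSharing A W u t).r β R i).eval (α : F) =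
      (subspacePoly W).eval (u i * (α - β)) * ((α : F) - β)⁻¹ * R.eval (α : F) := by
  obtain ⟨G, hG, -, -⟩ := exists_subspacePoly_eq_X_mul W
  have h0 : (α : F) - β ≠ 0 := sub_ne_zero.2 fun h' => h (Subtype.ext h')
  simp only [secretSharing]
  rw [subspacePoly_comp_divByMonic hG, hG]
  simp only [eval_mul, eval_comp, eval_C, eval_sub, eval_X]
  field_simp

/-- Fixing the queries prescribes `R` on `J`; the prescribed values depend on `β`, but their
probability does not. -/
theorem isPrivate_secretSharing [Nonempty A] : (secretSharing A W u t).IsPrivate t := by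
  refine CanonicalScheme.isPrivate_of_toOuterMeasure_eq fun J hJ κ =>
    ⟨((PMF.uniformOfFintype (Fin t → F)).map coeffPoly).toOuterMeasure
        {R | ∀ α ∈ J, R.eval (α : F) = 0},
      ne_top_of_le_ne_top ENNReal.one_ne_top (((PMF.toOuterMeasure _).mono (Set.subset_univ _)).trans_eq
        ((PMF.toOuterMeasure_apply_eq_one_iff _ _).2 (Set.subset_univ _))),
      fun β hβ => ?_⟩
  rw [law_secretSharing, ← toOuterMeasure_eval_coeffPoly_eq hJ fun α => κ α * ((α : F) - β)]
  congr 1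
  ext R
  refine forall₂_congr fun α hα => ?_
  have h0 : (α : F) - β ≠ 0 := sub_ne_zero.2 fun h' => hβ (Subtype.ext h' ▸ hα)
  simp only [CanonicalScheme.query, secretSharing]
  rw [inv_mul_eq_iff_eq_mul₀ h0, mul_comm]

theorem isRepairScheme_secretSharing [Fintype B] {k : ℕ} (u : Module.Basis (Fin l) B F)
    (ht : 1 ≤ t) (hn : A.card = Nat.card W + k + t - 1) (hA : 4 ≤ A.card) :
    (secretSharing A W u t).IsRepairScheme B k := by
  classical
  have hW : 0 < Nat.card W := Nat.card_pos
  obtain ⟨G, hG, hG0, hGd⟩ := exists_subspacePoly_eq_X_mul W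
  have hr : ∀ (β : A) (R : F[X]) (i : Fin l), (secretSharing A W u t).r β R i =
      C (u i) * G.comp (C (u i) * (X - C (β : F))) * R := by
    intro β R i
    simp only [secretSharing]
    rw [subspacePoly_comp_divByMonic hG]
  -- The degree is at most `(|W| - 1) + (t - 1) = n - k - 1`.
  have hdeg : ∀ β, ∀ R ∈ ((secretSharing A W u t).law β).support, ∀ i,
      ((secretSharing A W u t).r β R i).degree < ((A.card - k : ℕ) : WithBot ℕ) := by
    intro β R hR i
    rw [mem_support_law_secretSharing, ← natDegree_lt_iff_degree_lt_of_pos (by omega)] at hR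
    rw [← natDegree_lt_iff_degree_lt_of_pos (by omega), hr]
    have h1 : (C (u i) * G.comp (C (u i) * (X - C (β : F)))).natDegree ≤ Nat.card W - 1 := by
      refine (natDegree_C_mul_le _ _).trans ?_
      rw [natDegree_comp, hGd]
      refine (Nat.mul_le_mul_left _ ((natDegree_C_mul_le _ _).trans
        (natDegree_X_sub_C_le _))).trans (by omega)
    have := natDegree_mul_le (p := C (u i) * G.comp (C (u i) * (X - C (β : F)))) (q := R)
    omega
  refine ⟨?_, ?_, hdeg, ?_, ?_, ?_⟩
  · intro β R hR
    rw [mem_support_law_secretSharing, ← natDegree_lt_iff_degree_lt_of_pos (by omega)] at hR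
    exact Nat.le_sub_one_of_lt hR
  · intro β R hR _
    rw [mem_support_law_secretSharing, ← natDegree_lt_iff_degree_lt_of_pos (by omega)]
    exact lt_of_le_of_lt hR (Nat.sub_lt ht one_pos)
  · intro β R _ i α hα
    rw [eval_r_secretSharing hα]
    simp [secretSharing]
  · intro β R hR hRβ
    refine ⟨_, fun i => mem_dualCode_rsCode (hdeg β R hR i), ?_, rfl⟩
    have hrow : (secretSharing A W u t).evalMatrix β R β =
        fun i => (multiplier A β * (G.eval 0 * R.eval (β : F))) * u i := by
      funext i
      simp only [CanonicalScheme.evalMatrix]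
      rw [hr]
      simp only [eval_mul, eval_comp, eval_C, eval_sub, eval_X, sub_self, mul_zero]
      ring
    rw [hrow, finrank_range_mul_left B
      (mul_ne_zero (multiplier_ne_zero A β) (mul_ne_zero hG0 hRβ)), Set.finrank, u.span_eq,
      finrank_top, Module.finrank_eq_card_basis u, Fintype.card_fin]
  · have hcard : Fintype.card A = A.card := Fintype.card_coe A
    obtain ⟨β, β', hne⟩ := Fintype.one_lt_card_iff.1 (show 1 < Fintype.card A by omega)
    refine ⟨β, β', hne, ?_⟩
    rintro ⟨c, hc, h⟩
    -- Two points besides `β`, `β'` exist since `n ≥ 4`. Proportionality at both forces `c = 1`,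
    -- hence `β = β'`.
    obtain ⟨s, hs, hs2⟩ := Finset.exists_subset_card_eq
      (s := ((Finset.univ.erase β).erase β' : Finset A)) (n := 2) (by
        rw [Finset.card_erase_of_mem (by simp [hne.symm]), Finset.card_erase_of_mem (by simp),
          Finset.card_univ]
        omega)
    obtain ⟨x, y, hxy, rfl⟩ := Finset.card_eq_two.1 hs2
    have key : ∀ z ∈ ({x, y} : Finset A), (z : F) - β' = c * (z - β) := by
      intro z hz
      have hz' := hs hz
      simp only [Finset.mem_erase, Finset.mem_univ, and_true] at hz'
      have h1 : (z : F) - β ≠ 0 := sub_ne_zero.2 fun h' => hz'.2 (Subtype.ext h')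
      have h2 : (z : F) - β' ≠ 0 := sub_ne_zero.2 fun h' => hz'.1 (Subtype.ext h')
      have := h z hz'.2 hz'.1
      simp only [secretSharing] at this
      field_simp at this
      linear_combination this
    have hx := key x (by simp)
    have hy := key y (by simp)
    have hxy' : (x : F) - y ≠ 0 := sub_ne_zero.2 fun h' => hxy (Subtype.ext h')
    have hc1 : c = 1 := mul_right_cancel₀ hxy' (by linear_combination hy - hx)
    refine hne (Subtype.ext ?_)
    rw [hc1] at hx
    linear_combination hx

theorem bandwidth_secretSharing [Fintype B] (u : Module.Basis (Fin l) B F) (ht : 1 ≤ t) (β : A) :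
    (secretSharing A W u t).bandwidth B β =
      (((A.card - 1) * (Module.finrank B F - Module.finrank B W) : ℕ) : ℕ∞) := by
  classical
  have hcard : (Finset.univ.erase β : Finset A).card = A.card - 1 := by
    rw [Finset.card_erase_of_mem (Finset.mem_univ _), Finset.card_univ, Fintype.card_coe]
  have hrank : ∀ (R : F[X]) (α : A), α ≠ β → R.eval (α : F) ≠ 0 →
      Set.finrank B (Set.range fun i => ((secretSharing A W u t).r β R i).eval (α : F)) =
        Module.finrank B F - Module.finrank B W := by
    intro R α hα hR
    have h0 : (α : F) - β ≠ 0 := sub_ne_zero.2 fun h' => hα (Subtype.ext h')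
    refine Eq.trans ?_ ((finrank_range_mul_left B (mul_ne_zero (inv_ne_zero h0) hR) _).trans
      (finrank_range_eval_subspacePoly W u h0))
    congr 2
    funext i
    rw [eval_r_secretSharing hα]
    ring
  refine le_antisymm (iSup₂_le fun R _ => ?_) (le_iSup₂_of_le (1 : F[X])
    (mem_support_law_secretSharing.2 (by rw [degree_one]; exact_mod_cast ht)) ?_)
  · rw [CanonicalScheme.matrixBandwidth_evalMatrix, ← hcard]
    refine Nat.cast_le.2 (Finset.sum_le_card_nsmul _ _ _ fun α hα => ?_)
    -- Roots of `R` only lower the rank, so the maximum is reached at `R = 1`.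
    by_cases hR : R.eval (α : F) = 0
    · have hz : (fun i => ((secretSharing A W u t).r β R i).eval (α : F)) = fun _ => 0 := by
        funext i
        rw [eval_r_secretSharing (Finset.ne_of_mem_erase hα), hR, mul_zero]
      have hspan : Submodule.span B (Set.range fun _ : Fin l => (0 : F)) = ⊥ := by
        rw [Submodule.span_eq_bot]
        rintro _ ⟨_, rfl⟩
        rfl
      rw [hz, Set.finrank, hspan, finrank_bot]
      exact Nat.zero_le _
    · exact (hrank R α (Finset.ne_of_mem_erase hα) hR).le
  · rw [CanonicalScheme.matrixBandwidth_evalMatrix, ← hcard,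
      Finset.sum_congr rfl fun α hα => hrank 1 α (Finset.ne_of_mem_erase hα) (by simp)]
    simp

end SecretSharing

end PrivateRepair

theorem corollary2 {B F : Type*} [Field B] [Fintype B] [Field F] [Fintype F] [Algebra B F]
    (A : Finset F) [Nonempty A] (q l m n k t : ℕ)
    (hq : Fintype.card B = q) (hl : Module.finrank B F = l)
    (hA : A.card = n) (hF : Fintype.card F = n)
    (ht : 1 ≤ t) (htk : t < k) (hn : n = q ^ m + k + t - 1) :
    (∀ S : PrivateRepair.CanonicalScheme A l, S.IsRepairScheme B k → S.IsPrivate t →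
      ∀ β : A, (((n - 1) * (l - m) : ℕ) : ℕ∞) ≤ S.bandwidth B β) ∧
    (0 < m → ∀ (W : Submodule B F) (u : Module.Basis (Fin l) B F), Module.finrank B W = m →
      (PrivateRepair.secretSharing A W u t).IsRepairScheme B k ∧
      (PrivateRepair.secretSharing A W u t).IsPrivate t ∧
      ∀ β : A, (PrivateRepair.secretSharing A W u t).bandwidth B β =
        (((n - 1) * (l - m) : ℕ) : ℕ∞)) := by
  subst hA hq hl
  refine ⟨fun S hS hp β => hS.le_bandwidth hp ht htk
    (hF.symm.trans Module.card_eq_pow_finrank) hn β, fun hm W u hW => ?_⟩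
  subst hW
  have hWcard : Nat.card W = Fintype.card B ^ Module.finrank B W := by
    rw [Module.natCard_eq_pow_finrank (K := B), Nat.card_eq_fintype_card]
  have h2 : 2 ≤ Fintype.card B ^ Module.finrank B W :=
    Fintype.one_lt_card.trans_le (Nat.le_self_pow hm.ne' _)
  exact ⟨PrivateRepair.isRepairScheme_secretSharing u ht (by rw [hWcard]; exact hn) (by omega),
    PrivateRepair.isPrivate_secretSharing,
    fun β => PrivateRepair.bandwidth_secretSharing u ht β⟩
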